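/- Let $\otimes$ denote the minimal tensor product of unital $C^*$-algebras. A ($C^*$-algebraic compact) quantum group is a unital $C^*$-algebra $A$ with a unital $*$-homomorphism $\Delta:A\to A\otimes A$ such that $(\Delta\otimes\mathrm{id})\Delta=(\mathrm{id}\otimes\Delta)\Delta$ and such that the linear spans of $\{(a\otimes 1)\Delta(b) : a,b\in A\}$ and of $\{(1\otimes a)\Delta(b) : a,b\in A\}$ are dense in $A\otimes A$. An action of $(A,\Delta)$ on a compact metric space $(X,d)$ is a unital $*$-homomorphism $\rho:C(X)\to C(X)\otimes A$ such that $(\rho\otimes\mathrm{id})\rho=(\mathrm{id}\otimes\Delta)\rho$ and such that the linear span of $\{(1\otimes a)\rho(f) : a\in A,\ f\in C(X)\}$ is dense in $C(X)\otimes A$. For a Borel probability measure $\mu$ on $X$ and a state $\psi$ on $A$, let $\mu\triangleleft\psi$ be the Borel probability measure on $X$ determined by $\int_X f\,d(\mu\triangleleft\psi)=(\mu\otimes\psi)(\rho(f))$ for all $f\in C(X)$. For real $p\ge 1$ let $$W_p(\mu,\nu)=\inf_{\pi\in\Pi(\mu,\nu)}\left(\int_{X\times X}d(x,y)^p\,d\pi(x,y)\right)^{1/p},$$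 where $\Pi(\mu,\nu)$ is the set of Borel probability measures on $X\times X$ with marginals $\mu$ and $\nu$. The action satisfies condition $(\mathrm{Lip}_p)$ if $W_p(\mu\triangleleft\psi,\nu\triangleleft\psi)\le W_p(\mu,\nu)$ for all Borel probability measures $\mu,\nu$ on $X$ and all states $\psi$ on $A$. **Corollary.** For every action of a quantum group on a compact metric space $X$ and all real numbers $1\le q\le p$, condition $(\mathrm{Lip}_p)$ implies condition $(\mathrm{Lip}_q)$. -/

import Mathlib

open MeasureTheory UniformSpace
open scoped TensorProduct ComplexOrder InnerProductSpace

universe u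

namespace QuantumIsometry

noncomputable section

/-- The Hilbert space tensor product: the completion of the algebraic tensor product in the norm
of the inner product with `⟪x ⊗ y, x' ⊗ y'⟫ = ⟪x, x'⟫ * ⟪y, y'⟫`. -/
def HilbertTensor (E F : Type u) [NormedAddCommGroup E] [InnerProductSpace ℂ E]
    [NormedAddCommGroup F] [InnerProductSpace ℂ F] : Type u :=
  Completion (E ⊗[ℂ] F)

namespace HilbertTensor

variable {E F : Type u} [NormedAddCommGroup E] [InnerProductSpace ℂ E]
  [NormedAddCommGroup F] [InnerProductSpace ℂ F]

instance : NormedAddCommGroup (HilbertTensor E F) :=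
  inferInstanceAs (NormedAddCommGroup (Completion (E ⊗[ℂ] F)))

instance : InnerProductSpace ℂ (HilbertTensor E F) :=
  inferInstanceAs (InnerProductSpace ℂ (Completion (E ⊗[ℂ] F)))

instance : CompleteSpace (HilbertTensor E F) :=
  inferInstanceAs (CompleteSpace (Completion (E ⊗[ℂ] F)))

/-- The canonical isometric embedding of the algebraic tensor product. -/
def incl : E ⊗[ℂ] F →ₗᵢ[ℂ] HilbertTensor E F := Completion.toComplₗᵢ

lemma denseRange_incl : DenseRange (incl : E ⊗[ℂ] F → HilbertTensor E F) :=
  Completion.denseRange_coe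

lemma inner_incl_tmul (x x' : E) (y y' : F) :
    ⟪(incl (x ⊗ₜ[ℂ] y) : HilbertTensor E F), incl (x' ⊗ₜ[ℂ] y')⟫_ℂ = ⟪x, x'⟫_ℂ * ⟪y, y'⟫_ℂ := by
  rw [LinearIsometry.inner_map_map, TensorProduct.inner_tmul]

lemma norm_incl_tmul (x : E) (y : F) :
    ‖(incl (x ⊗ₜ[ℂ] y) : HilbertTensor E F)‖ = ‖x‖ * ‖y‖ := by
  rw [LinearIsometry.norm_map, TensorProduct.norm_tmul]

lemma clm_ext {S T : HilbertTensor E F →L[ℂ] HilbertTensor E F}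
    (h : ∀ x y, S (incl (x ⊗ₜ y)) = T (incl (x ⊗ₜ y))) : S = T := by
  refine ContinuousLinearMap.coeFn_injective
    (denseRange_incl.equalizer S.continuous T.continuous (funext fun z => ?_))
  induction z using TensorProduct.induction_on with
  | zero => simp
  | tmul x y => exact h x y
  | add x y hx hy =>
    simp only [Function.comp_apply, map_add] at hx hy ⊢
    rw [hx, hy]

/-- The operator `S ⊗ T` on the Hilbert space tensor product. -/
def map (S : E →L[ℂ] E) (T : F →L[ℂ] F) : HilbertTensor E F →L[ℂ] HilbertTensor E F :=
  ContinuousLinearMap.completion (TensorProduct.mapL S T)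

lemma map_incl (S : E →L[ℂ] E) (T : F →L[ℂ] F) (z : E ⊗[ℂ] F) :
    map S T (incl z) = incl (TensorProduct.mapL S T z) :=
  ContinuousLinearMap.completion_apply_coe (TensorProduct.mapL S T) z

lemma map_tmul (S : E →L[ℂ] E) (T : F →L[ℂ] F) (x : E) (y : F) :
    map S T (incl (x ⊗ₜ y)) = incl (S x ⊗ₜ T y) := by
  rw [map_incl, TensorProduct.mapL_tmul]

lemma map_add_left (S S' : E →L[ℂ] E) (T : F →L[ℂ] F) : map (S + S') T = map S T + map S' T :=
  clm_ext fun x y => by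
    simp only [map_tmul, add_apply, TensorProduct.add_tmul, map_add]

lemma map_add_right (S : E →L[ℂ] E) (T T' : F →L[ℂ] F) : map S (T + T') = map S T + map S T' :=
  clm_ext fun x y => by
    simp only [map_tmul, add_apply, TensorProduct.tmul_add, map_add]

lemma map_smul_left (c : ℂ) (S : E →L[ℂ] E) (T : F →L[ℂ] F) : map (c • S) T = c • map S T :=
  clm_ext fun x y => by
    rw [map_tmul, smul_apply, smul_apply, map_tmul, ← LinearIsometry.map_smul,
      TensorProduct.smul_tmul']

lemma map_smul_right (c : ℂ) (S : E →L[ℂ] E) (T : F →L[ℂ] F) : map S (c • T) = c • map S T :=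
  clm_ext fun x y => by
    simp only [map_tmul, smul_apply, TensorProduct.tmul_smul, map_smul]

lemma map_mul (S S' : E →L[ℂ] E) (T T' : F →L[ℂ] F) :
    map (S * S') (T * T') = map S T * map S' T' :=
  clm_ext fun x y => by
    simp only [map_tmul, mul_apply_eq_comp]

lemma map_one : map (1 : E →L[ℂ] E) (1 : F →L[ℂ] F) = 1 :=
  clm_ext fun x y => by
    simp only [map_tmul, one_apply_eq_self]

lemma norm_map_le (S : E →L[ℂ] E) (T : F →L[ℂ] F) : ‖map S T‖ ≤ ‖S‖ * ‖T‖ := by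
  have h0 : 0 ≤ ‖S‖ * ‖T‖ := mul_nonneg (norm_nonneg _) (norm_nonneg _)
  refine ContinuousLinearMap.opNorm_le_bound _ h0 fun z => ?_
  induction z using denseRange_incl.induction_on with
  | hp => exact isClosed_le (by fun_prop) (by fun_prop)
  | ih z =>
    rw [map_incl, LinearIsometry.norm_map, LinearIsometry.norm_map]
    exact (ContinuousLinearMap.le_opNorm _ _).trans
      (mul_le_mul_of_nonneg_right (TensorProduct.norm_mapL_le S T) (norm_nonneg _))

lemma star_map [CompleteSpace E] [CompleteSpace F] (S : E →L[ℂ] E) (T : F →L[ℂ] F) :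
    star (map S T) = map (star S) (star T) := by
  refine clm_ext fun x y => ?_
  refine denseRange_incl.eq_of_inner_right ℂ fun z => ?_
  induction z using TensorProduct.induction_on with
  | zero => simp
  | add z w hz hw => simp only [_root_.map_add, inner_add_left, hz, hw]
  | tmul x' y' =>
    rw [ContinuousLinearMap.star_eq_adjoint, ContinuousLinearMap.adjoint_inner_right, map_tmul,
      map_tmul, inner_incl_tmul, inner_incl_tmul, ContinuousLinearMap.star_eq_adjoint,
      ContinuousLinearMap.star_eq_adjoint, ContinuousLinearMap.adjoint_inner_right,
      ContinuousLinearMap.adjoint_inner_right]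

end HilbertTensor

/-- A unital `*`-representation of the C*-algebra `A` on a Hilbert space. -/
structure HilbertRep (A : Type u) [CStarAlgebra A] : Type (u + 1) where
  H : Type u
  [normed : NormedAddCommGroup H]
  [inner : InnerProductSpace ℂ H]
  [complete : CompleteSpace H]
  π : A →⋆ₐ[ℂ] (H →L[ℂ] H)

attribute [instance] HilbertRep.normed HilbertRep.inner HilbertRep.complete

namespace HilbertRep

variable {A A' B B' : Type u} [CStarAlgebra A] [CStarAlgebra A'] [CStarAlgebra B] [CStarAlgebra B']

/-- Restriction of a representation along a `*`-homomorphism. -/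
def comp (P : HilbertRep A') (f : A →⋆ₐ[ℂ] A') : HilbertRep A where
  H := P.H
  π := P.π.comp f

/-- The representation `π_P ⊗ π_Q` of the algebraic tensor product `A ⊗ B` on the tensor product
of the two Hilbert spaces, with `a ⊗ b` acting as `π_P(a) ⊗ π_Q(b)`. -/
def tensor (P : HilbertRep A) (Q : HilbertRep B) :
    A ⊗[ℂ] B →ₐ[ℂ] (HilbertTensor P.H Q.H →L[ℂ] HilbertTensor P.H Q.H) :=
  Algebra.TensorProduct.algHomOfLinearMapTensorProduct
    (TensorProduct.lift
      (LinearMap.mk₂ ℂ (fun (a : A) (b : B) => HilbertTensor.map (P.π a) (Q.π b))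
        (fun a a' b => by rw [map_add, HilbertTensor.map_add_left])
        (fun c a b => by rw [map_smul, HilbertTensor.map_smul_left])
        (fun a b b' => by rw [map_add, HilbertTensor.map_add_right])
        (fun c a b => by rw [map_smul, HilbertTensor.map_smul_right])))
    (fun a₁ a₂ b₁ b₂ => by simp [HilbertTensor.map_mul])
    (by
      simp only [TensorProduct.lift.tmul, LinearMap.mk₂_apply, map_one]
      exact HilbertTensor.map_one)

lemma tensor_tmul (P : HilbertRep A) (Q : HilbertRep B) (a : A) (b : B) :
    P.tensor Q (a ⊗ₜ b) = HilbertTensor.map (P.π a) (Q.π b) :=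
  rfl

lemma norm_π_le (P : HilbertRep A) (a : A) : ‖P.π a‖ ≤ ‖a‖ :=
  NonUnitalStarAlgHom.norm_apply_le P.π a

lemma tensor_star (P : HilbertRep A) (Q : HilbertRep B) (x : A ⊗[ℂ] B) :
    P.tensor Q (star x) = star (P.tensor Q x) := by
  induction x using TensorProduct.induction_on with
  | zero => simp
  | add x y hx hy => rw [star_add, map_add, map_add, star_add, hx, hy]
  | tmul a b =>
    rw [TensorProduct.star_tmul, tensor_tmul, tensor_tmul, HilbertTensor.star_map, map_star,
      map_star]

lemma comp_tensor_comp (P : HilbertRep A') (Q : HilbertRep B') (f : A →⋆ₐ[ℂ] A')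
    (g : B →⋆ₐ[ℂ] B') (x : A ⊗[ℂ] B) :
    (P.comp f).tensor (Q.comp g) x =
      P.tensor Q (Algebra.TensorProduct.map f.toAlgHom g.toAlgHom x) := by
  induction x using TensorProduct.induction_on with
  | zero => rw [map_zero, map_zero, map_zero]; rfl
  | add x y hx hy => rw [map_add, map_add, map_add, hx, hy]; rfl
  | tmul a b => rfl

end HilbertRep

/-- The minimal (spatial) C*-norm on the algebraic tensor product `A ⊗ B`:
`‖x‖_min = sup ‖(π ⊗ σ)(x)‖` over all representations `π` of `A` and `σ` of `B`. -/
def minNorm {A B : Type u} [CStarAlgebra A] [CStarAlgebra B] (x : A ⊗[ℂ] B) : ℝ :=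
  ⨆ R : HilbertRep A × HilbertRep B, ‖R.1.tensor R.2 x‖

section minNorm

variable {A A' B B' : Type u} [CStarAlgebra A] [CStarAlgebra A'] [CStarAlgebra B] [CStarAlgebra B']

lemma bddAbove_minNorm (x : A ⊗[ℂ] B) :
    BddAbove (Set.range fun R : HilbertRep A × HilbertRep B => ‖R.1.tensor R.2 x‖) := by
  induction x using TensorProduct.induction_on with
  | zero => exact ⟨0, by rintro _ ⟨R, rfl⟩; simp⟩
  | tmul a b =>
    refine ⟨‖a‖ * ‖b‖, ?_⟩
    rintro _ ⟨R, rfl⟩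
    simp only [HilbertRep.tensor_tmul]
    refine (HilbertTensor.norm_map_le _ _).trans ?_
    gcongr
    · exact R.1.norm_π_le a
    · exact R.2.norm_π_le b
  | add x y hx hy =>
    obtain ⟨C, hC⟩ := hx
    obtain ⟨D, hD⟩ := hy
    refine ⟨C + D, ?_⟩
    rintro _ ⟨R, rfl⟩
    simp only [map_add]
    exact (norm_add_le _ _).trans (add_le_add (hC ⟨R, rfl⟩) (hD ⟨R, rfl⟩))

lemma norm_tensor_le_minNorm (P : HilbertRep A) (Q : HilbertRep B) (x : A ⊗[ℂ] B) :
    ‖P.tensor Q x‖ ≤ minNorm x :=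
  le_ciSup (bddAbove_minNorm x) (P, Q)

lemma minNorm_nonneg (x : A ⊗[ℂ] B) : 0 ≤ minNorm x :=
  Real.iSup_nonneg fun _ => norm_nonneg _

lemma minNorm_le {x : A ⊗[ℂ] B} {C : ℝ} (hC : 0 ≤ C)
    (h : ∀ (P : HilbertRep A) (Q : HilbertRep B), ‖P.tensor Q x‖ ≤ C) : minNorm x ≤ C :=
  Real.iSup_le (fun R => h R.1 R.2) hC

lemma minNorm_mul_le (x y : A ⊗[ℂ] B) : minNorm (x * y) ≤ minNorm x * minNorm y := by
  refine minNorm_le (mul_nonneg (minNorm_nonneg x) (minNorm_nonneg y)) fun P Q => ?_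
  rw [map_mul]
  exact (norm_mul_le _ _).trans (mul_le_mul (norm_tensor_le_minNorm P Q x)
    (norm_tensor_le_minNorm P Q y) (norm_nonneg _) (minNorm_nonneg x))

/-- The minimal C*-norm as a ring seminorm. -/
def minSeminorm (A B : Type u) [CStarAlgebra A] [CStarAlgebra B] : RingSeminorm (A ⊗[ℂ] B) where
  toFun := minNorm
  map_zero' := le_antisymm (minNorm_le le_rfl fun P Q => by simp) (minNorm_nonneg _)
  add_le' x y := minNorm_le (add_nonneg (minNorm_nonneg x) (minNorm_nonneg y)) fun P Q => by
    rw [map_add]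
    exact (norm_add_le _ _).trans
      (add_le_add (norm_tensor_le_minNorm P Q x) (norm_tensor_le_minNorm P Q y))
  neg' x := by simp [minNorm]
  mul_le' := minNorm_mul_le

lemma minNorm_smul_le (c : ℂ) (x : A ⊗[ℂ] B) : minNorm (c • x) ≤ ‖c‖ * minNorm x := by
  refine minNorm_le (mul_nonneg (norm_nonneg _) (minNorm_nonneg x)) fun P Q => ?_
  rw [map_smul, norm_smul]
  gcongr
  exact norm_tensor_le_minNorm P Q x

lemma minNorm_sq_le (x : A ⊗[ℂ] B) : minNorm x * minNorm x ≤ minNorm (star x * x) := by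
  have h : minNorm x ≤ Real.sqrt (minNorm (star x * x)) :=
    minNorm_le (Real.sqrt_nonneg _) fun P Q => Real.le_sqrt_of_sq_le (by
      rw [sq, ← CStarRing.norm_star_mul_self, ← P.tensor_star Q, ← map_mul]
      exact norm_tensor_le_minNorm P Q _)
  calc _ ≤ Real.sqrt (minNorm (star x * x)) * Real.sqrt (minNorm (star x * x)) := by
        gcongr; exact minNorm_nonneg x
    _ = _ := Real.mul_self_sqrt (minNorm_nonneg _)

lemma minNorm_star_le (x : A ⊗[ℂ] B) : minNorm (star x) ≤ minNorm x :=
  minNorm_le (minNorm_nonneg x) fun P Q => by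
    rw [P.tensor_star Q, norm_star]
    exact norm_tensor_le_minNorm P Q x

lemma minNorm_map_le (f : A →⋆ₐ[ℂ] A') (g : B →⋆ₐ[ℂ] B') (x : A ⊗[ℂ] B) :
    minNorm (Algebra.TensorProduct.map f.toAlgHom g.toAlgHom x) ≤ minNorm x :=
  minNorm_le (minNorm_nonneg x) fun P Q => by
    rw [← HilbertRep.comp_tensor_comp]
    exact norm_tensor_le_minNorm _ _ x

end minNorm

/-- The algebraic tensor product `A ⊗ B`, equipped with the minimal C*-norm. -/
def AlgTensor (A B : Type u) [CStarAlgebra A] [CStarAlgebra B] : Type u := A ⊗[ℂ] B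

namespace AlgTensor

variable (A B : Type u) [CStarAlgebra A] [CStarAlgebra B]

instance : SeminormedRing (AlgTensor A B) := (minSeminorm A B).toSeminormedRing

instance : StarRing (AlgTensor A B) := inferInstanceAs (StarRing (A ⊗[ℂ] B))

instance : Algebra ℂ (AlgTensor A B) := inferInstanceAs (Algebra ℂ (A ⊗[ℂ] B))

instance : NormedAlgebra ℂ (AlgTensor A B) where
  norm_smul_le c x := minNorm_smul_le (A := A) (B := B) c x

instance : StarModule ℂ (AlgTensor A B) := inferInstanceAs (StarModule ℂ (A ⊗[ℂ] B))

instance : NormedStarGroup (AlgTensor A B) where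
  norm_star_le x := minNorm_star_le (A := A) (B := B) x

lemma norm_mul_self_le (x : AlgTensor A B) : ‖x‖ * ‖x‖ ≤ ‖star x * x‖ :=
  minNorm_sq_le (A := A) (B := B) x

end AlgTensor

/-- The minimal tensor product of two C*-algebras: the completion of the algebraic tensor product
in the minimal C*-norm. -/
def MinTensor (A B : Type u) [CStarAlgebra A] [CStarAlgebra B] : Type u :=
  Completion (AlgTensor A B)

namespace MinTensor

section instances

variable (A B : Type u) [CStarAlgebra A] [CStarAlgebra B]

instance : NormedRing (MinTensor A B) := inferInstanceAs (NormedRing (Completion (AlgTensor A B)))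

instance : CompleteSpace (MinTensor A B) :=
  inferInstanceAs (CompleteSpace (Completion (AlgTensor A B)))

instance : Algebra ℂ (MinTensor A B) := inferInstanceAs (Algebra ℂ (Completion (AlgTensor A B)))

instance : NormedAlgebra ℂ (MinTensor A B) where
  norm_smul_le c x := norm_smul_le (α := ℂ) (β := Completion (AlgTensor A B)) c x

instance : Star (MinTensor A B) := ⟨Completion.map (star : AlgTensor A B → AlgTensor A B)⟩

end instances

variable {A A' B B' : Type u} [CStarAlgebra A] [CStarAlgebra A'] [CStarAlgebra B] [CStarAlgebra B']

/-- The canonical map of the algebraic tensor product into the minimal tensor product, as an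
algebra homomorphism. -/
def coeAlgHom : A ⊗[ℂ] B →ₐ[ℂ] MinTensor A B where
  toFun x := ((show AlgTensor A B from x : AlgTensor A B) : Completion (AlgTensor A B))
  map_one' := rfl
  map_zero' := rfl
  map_mul' x y := Completion.coe_mul (α := AlgTensor A B) x y
  map_add' x y := Completion.coe_add (α := AlgTensor A B) x y
  commutes' _ := rfl

lemma denseRange_coe : DenseRange (coeAlgHom : A ⊗[ℂ] B → MinTensor A B) :=
  Completion.denseRange_coe (α := AlgTensor A B)

lemma norm_coe (x : A ⊗[ℂ] B) : ‖(coeAlgHom x : MinTensor A B)‖ = minNorm x :=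
  Completion.norm_coe (E := AlgTensor A B) x

lemma continuous_star : Continuous (star : MinTensor A B → MinTensor A B) :=
  Completion.continuous_map

lemma star_coe (x : A ⊗[ℂ] B) :
    star (coeAlgHom x : MinTensor A B) = coeAlgHom (star x) :=
  Completion.map_coe (α := AlgTensor A B) (β := AlgTensor A B)
    (uniformContinuous_of_continuousAt_zero (starAddEquiv (R := AlgTensor A B)).toAddMonoidHom
      (ContinuousStar.continuous_star (R := AlgTensor A B)).continuousAt) x

instance : StarRing (MinTensor A B) where
  star_involutive x := by
    induction x using denseRange_coe.induction_on with
    | hp => exact isClosed_eq (continuous_star.comp continuous_star) continuous_id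
    | ih x => rw [star_coe, star_coe, star_star]
  star_mul x y := by
    induction x, y using denseRange_coe.induction_on₂ with
    | hp =>
      exact isClosed_eq (continuous_star.comp (continuous_fst.mul continuous_snd))
        ((continuous_star.comp continuous_snd).mul (continuous_star.comp continuous_fst))
    | h x y => rw [← map_mul, star_coe, star_coe, star_coe, star_mul, map_mul]
  star_add x y := by
    induction x, y using denseRange_coe.induction_on₂ with
    | hp =>
      exact isClosed_eq (continuous_star.comp (continuous_fst.add continuous_snd))
        ((continuous_star.comp continuous_fst).add (continuous_star.comp continuous_snd))
    | h x y => rw [← map_add, star_coe, star_coe, star_coe, star_add, map_add]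

instance : CStarAlgebra (MinTensor A B) where
  star_smul c x := by
    induction x using denseRange_coe.induction_on with
    | hp =>
      exact isClosed_eq (continuous_star.comp (continuous_const_smul c))
        ((continuous_const_smul (star c)).comp continuous_star)
    | ih x => rw [← map_smul, star_coe, star_coe, star_smul, map_smul]
  norm_mul_self_le x := by
    induction x using denseRange_coe.induction_on with
    | hp =>
      exact isClosed_le (continuous_norm.mul continuous_norm)
        (continuous_norm.comp (continuous_star.mul continuous_id))
    | ih x => rw [star_coe, ← map_mul, norm_coe, norm_coe]; exact minNorm_sq_le x

/-- The elementary tensor `a ⊗ b` in the minimal tensor product. -/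
def tmul (a : A) (b : B) : MinTensor A B := coeAlgHom (a ⊗ₜ[ℂ] b)

/-- Extension by continuity of a linear map that is bounded in the minimal C*-norm. -/
def extend {V : Type*} [NormedAddCommGroup V] [NormedSpace ℂ V] [CompleteSpace V]
    (φ : A ⊗[ℂ] B →ₗ[ℂ] V) (hφ : ∀ x, ‖φ x‖ ≤ minNorm x) : MinTensor A B →L[ℂ] V :=
  ContinuousLinearMap.fromCompletion (α := AlgTensor A B)
    (LinearMap.mkContinuous (E := AlgTensor A B)
      { toFun := fun x => φ x, map_add' := fun x y => φ.map_add x y,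
        map_smul' := fun c x => φ.map_smul c x } 1
      fun x => (hφ x).trans_eq (one_mul _).symm)

lemma extend_coe {V : Type*} [NormedAddCommGroup V] [NormedSpace ℂ V] [CompleteSpace V]
    (φ : A ⊗[ℂ] B →ₗ[ℂ] V) (hφ : ∀ x, ‖φ x‖ ≤ minNorm x) (x : A ⊗[ℂ] B) :
    extend φ hφ (coeAlgHom x) = φ x :=
  ContinuousLinearMap.fromCompletion_apply_coe (α := AlgTensor A B) _ _

/-- The `*`-homomorphism `f ⊗ g` between algebraic tensor products, with values in the minimal
tensor product. -/
def mapAlg (f : A →⋆ₐ[ℂ] A') (g : B →⋆ₐ[ℂ] B') : A ⊗[ℂ] B →ₐ[ℂ] MinTensor A' B' :=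
  coeAlgHom.comp (Algebra.TensorProduct.map f.toAlgHom g.toAlgHom)

lemma mapAlg_tmul (f : A →⋆ₐ[ℂ] A') (g : B →⋆ₐ[ℂ] B') (a : A) (b : B) :
    mapAlg f g (a ⊗ₜ b) = tmul (f a) (g b) := rfl

lemma mapAlg_star (f : A →⋆ₐ[ℂ] A') (g : B →⋆ₐ[ℂ] B') (x : A ⊗[ℂ] B) :
    mapAlg f g (star x) = star (mapAlg f g x) := by
  induction x using TensorProduct.induction_on with
  | zero => simp
  | add x y hx hy => rw [star_add, map_add, map_add, star_add, hx, hy]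
  | tmul a b =>
    rw [TensorProduct.star_tmul, mapAlg_tmul, mapAlg_tmul, tmul, tmul, star_coe,
      TensorProduct.star_tmul, map_star, map_star]

/-- The underlying continuous linear map of `f ⊗ g`. -/
def mapCLM (f : A →⋆ₐ[ℂ] A') (g : B →⋆ₐ[ℂ] B') : MinTensor A B →L[ℂ] MinTensor A' B' :=
  extend (mapAlg f g).toLinearMap fun x => (norm_coe _).trans_le (minNorm_map_le f g x)

lemma mapCLM_coe (f : A →⋆ₐ[ℂ] A') (g : B →⋆ₐ[ℂ] B') (x : A ⊗[ℂ] B) :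
    mapCLM f g (coeAlgHom x) = mapAlg f g x :=
  extend_coe _ _ _

/-- The `*`-homomorphism `f ⊗ g` between minimal tensor products, the continuous extension of
`a ⊗ b ↦ f a ⊗ g b`. -/
def map (f : A →⋆ₐ[ℂ] A') (g : B →⋆ₐ[ℂ] B') : MinTensor A B →⋆ₐ[ℂ] MinTensor A' B' where
  toFun := mapCLM f g
  map_one' := by rw [← map_one coeAlgHom, mapCLM_coe, map_one]
  map_zero' := map_zero _
  map_add' := map_add _
  map_mul' x y := by
    induction x, y using denseRange_coe.induction_on₂ with
    | hp =>
      exact isClosed_eq ((mapCLM f g).continuous.comp (continuous_fst.mul continuous_snd))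
        (((mapCLM f g).continuous.comp continuous_fst).mul
          ((mapCLM f g).continuous.comp continuous_snd))
    | h x y => rw [← map_mul, mapCLM_coe, mapCLM_coe, mapCLM_coe, map_mul]
  commutes' c := by
    rw [← AlgHom.commutes coeAlgHom c, mapCLM_coe, AlgHom.commutes]
  map_star' x := by
    induction x using denseRange_coe.induction_on with
    | hp =>
      exact isClosed_eq ((mapCLM f g).continuous.comp continuous_star)
        (continuous_star.comp (mapCLM f g).continuous)
    | ih x => rw [star_coe, mapCLM_coe, mapCLM_coe, mapAlg_star]

lemma map_tmul (f : A →⋆ₐ[ℂ] A') (g : B →⋆ₐ[ℂ] B') (a : A) (b : B) :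
    map f g (tmul a b) = tmul (f a) (g b) :=
  mapCLM_coe f g _

section assoc

variable {C : Type u} [CStarAlgebra C]

/-- The canonical map of the algebraic tensor product `(A ⊗ B) ⊗ C` into the minimal one. -/
def coeLeft : (A ⊗[ℂ] B) ⊗[ℂ] C →ₐ[ℂ] MinTensor (MinTensor A B) C :=
  coeAlgHom.comp (Algebra.TensorProduct.map coeAlgHom (AlgHom.id ℂ C))

/-- The canonical map of the algebraic tensor product `A ⊗ (B ⊗ C)` into the minimal one. -/
def coeRight : A ⊗[ℂ] (B ⊗[ℂ] C) →ₐ[ℂ] MinTensor A (MinTensor B C) :=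
  coeAlgHom.comp (Algebra.TensorProduct.map (AlgHom.id ℂ A) coeAlgHom)

/-- `u ∈ (A ⊗ B) ⊗ C` and `v ∈ A ⊗ (B ⊗ C)` are the same element of the triple minimal tensor
product `A ⊗ B ⊗ C`, i.e. they correspond to each other under the canonical isomorphism
`(A ⊗ B) ⊗ C ≅ A ⊗ (B ⊗ C)`. That isomorphism is the continuous extension of the associativity
isomorphism of the dense algebraic tensor products, which is isometric for the minimal norms;
hence its graph is the closure of the graph of the algebraic associativity isomorphism. -/
def IsAssoc (u : MinTensor (MinTensor A B) C) (v : MinTensor A (MinTensor B C)) : Prop :=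
  (u, v) ∈ closure (Set.range fun x : (A ⊗[ℂ] B) ⊗[ℂ] C =>
    ((coeLeft x, coeRight (TensorProduct.assoc ℂ A B C x)) :
      MinTensor (MinTensor A B) C × MinTensor A (MinTensor B C)))

end assoc

end MinTensor

/-- A state on the unital C*-algebra `A`: a unital positive continuous linear functional. -/
structure State (A : Type u) [CStarAlgebra A] where
  toCLM : A →L[ℂ] ℂ
  map_one' : toCLM 1 = 1
  nonneg' : ∀ a, 0 ≤ toCLM (star a * a)

namespace State

variable {A A' B : Type u} [CStarAlgebra A] [CStarAlgebra A'] [CStarAlgebra B]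

instance : CoeFun (State A) fun _ => A → ℂ := ⟨fun φ => φ.toCLM⟩

/-- Every state is a vector state in some representation (the GNS construction). -/
lemma exists_vector (φ : State A) :
    ∃ (P : HilbertRep A) (ξ : P.H), ‖ξ‖ = 1 ∧ ∀ a, φ a = ⟪ξ, P.π a ξ⟫_ℂ := by
  let _ : PartialOrder A := CStarAlgebra.spectralOrder A
  have : StarOrderedRing A := CStarAlgebra.spectralOrderedRing A
  let f : A →ₚ[ℂ] ℂ := PositiveLinearMap.mk₀ φ.toCLM.toLinearMap fun a ha => by
    obtain ⟨b, rfl⟩ := CStarAlgebra.nonneg_iff_eq_star_mul_self.mp ha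
    exact φ.nonneg' b
  have hf : ∀ a, φ a = ⟪((f.toPreGNS 1 : f.PreGNS) : f.GNS),
      f.gnsStarAlgHom a ((f.toPreGNS 1 : f.PreGNS) : f.GNS)⟫_ℂ := fun a => by
    have h : f.gnsStarAlgHom a ((f.toPreGNS 1 : f.PreGNS) : f.GNS) =
        ((f.leftMulMapPreGNS a (f.toPreGNS 1) : f.PreGNS) : f.GNS) :=
      f.gnsNonUnitalStarAlgHom_apply_coe
    rw [h, Completion.inner_coe, PositiveLinearMap.preGNS_inner_def]
    simp only [PositiveLinearMap.leftMulMapPreGNS_apply, PositiveLinearMap.ofPreGNS_toPreGNS,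
      star_one, one_mul, mul_one]
    rfl
  refine ⟨{ H := f.GNS, π := f.gnsStarAlgHom }, ((f.toPreGNS 1 : f.PreGNS) : f.GNS), ?_, hf⟩
  have h1 := hf 1
  rw [φ.map_one', map_one (PositiveLinearMap.gnsStarAlgHom f), one_apply_eq_self,
    inner_self_eq_norm_sq_to_K, RCLike.ofReal_eq_complex_ofReal] at h1
  have h2 : ‖((f.toPreGNS 1 : f.PreGNS) : f.GNS)‖ ^ 2 = 1 := by exact_mod_cast h1.symm
  exact (pow_eq_one_iff_of_nonneg (norm_nonneg _) two_ne_zero).mp h2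

/-- The pull-back of a state along a unital `*`-homomorphism. -/
def comp (φ : State A') (f : A →⋆ₐ[ℂ] A') : State A where
  toCLM := φ.toCLM.comp
    (f.toAlgHom.toLinearMap.mkContinuous 1 fun a => by
      rw [one_mul]; exact NonUnitalStarAlgHom.norm_apply_le f a)
  map_one' := by
    show φ (f 1) = 1
    rw [map_one]; exact φ.map_one'
  nonneg' a := by
    show 0 ≤ φ (f (star a * a))
    rw [map_mul, map_star]; exact φ.nonneg' _

lemma comp_apply (φ : State A') (f : A →⋆ₐ[ℂ] A') (a : A) : φ.comp f a = φ (f a) := rfl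

/-- The functional `a ⊗ b ↦ φ(a) ψ(b)` on the algebraic tensor product. -/
def prodAlg (φ : State A) (ψ : State B) : A ⊗[ℂ] B →ₗ[ℂ] ℂ :=
  LinearMap.mul' ℂ ℂ ∘ₗ TensorProduct.map φ.toCLM.toLinearMap ψ.toCLM.toLinearMap

lemma prodAlg_tmul (φ : State A) (ψ : State B) (a : A) (b : B) :
    prodAlg φ ψ (a ⊗ₜ b) = φ a * ψ b := rfl

lemma exists_vector_prod (φ : State A) (ψ : State B) :
    ∃ (P : HilbertRep A) (Q : HilbertRep B) (ζ : HilbertTensor P.H Q.H), ‖ζ‖ = 1 ∧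
      ∀ x, prodAlg φ ψ x = ⟪ζ, P.tensor Q x ζ⟫_ℂ := by
  obtain ⟨P, ξ, hξ, hP⟩ := φ.exists_vector
  obtain ⟨Q, η, hη, hQ⟩ := ψ.exists_vector
  refine ⟨P, Q, HilbertTensor.incl (ξ ⊗ₜ η), ?_, fun x => ?_⟩
  · rw [HilbertTensor.norm_incl_tmul, hξ, hη, one_mul]
  · induction x using TensorProduct.induction_on with
    | zero => simp
    | add x y hx hy => rw [map_add, map_add, hx, hy, add_apply, inner_add_right]
    | tmul a b =>
      rw [prodAlg_tmul, HilbertRep.tensor_tmul, HilbertTensor.map_tmul,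
        HilbertTensor.inner_incl_tmul, hP, hQ]

lemma norm_prodAlg_le (φ : State A) (ψ : State B) (x : A ⊗[ℂ] B) :
    ‖prodAlg φ ψ x‖ ≤ minNorm x := by
  obtain ⟨P, Q, ζ, hζ, h⟩ := exists_vector_prod φ ψ
  rw [h]
  refine (norm_inner_le_norm _ _).trans ?_
  rw [hζ, one_mul]
  refine (ContinuousLinearMap.le_opNorm _ _).trans ?_
  rw [hζ, mul_one]
  exact norm_tensor_le_minNorm P Q x

lemma prodAlg_nonneg (φ : State A) (ψ : State B) (x : A ⊗[ℂ] B) :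
    0 ≤ prodAlg φ ψ (star x * x) := by
  obtain ⟨P, Q, ζ, -, h⟩ := exists_vector_prod φ ψ
  rw [h, map_mul, P.tensor_star Q, mul_apply_eq_comp, ContinuousLinearMap.star_eq_adjoint,
    ContinuousLinearMap.adjoint_inner_right, inner_self_eq_norm_sq_to_K,
    RCLike.ofReal_eq_complex_ofReal]
  exact_mod_cast sq_nonneg ‖P.tensor Q x ζ‖

/-- The product state `φ ⊗ ψ` on the minimal tensor product, the continuous extension of
`a ⊗ b ↦ φ(a) ψ(b)`. -/
def prod (φ : State A) (ψ : State B) : State (MinTensor A B) where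
  toCLM := MinTensor.extend (prodAlg φ ψ) (norm_prodAlg_le φ ψ)
  map_one' := by
    rw [← map_one MinTensor.coeAlgHom, MinTensor.extend_coe, Algebra.TensorProduct.one_def,
      prodAlg_tmul, φ.map_one', ψ.map_one', one_mul]
  nonneg' x := by
    induction x using MinTensor.denseRange_coe.induction_on with
    | hp =>
      exact isClosed_le continuous_const ((ContinuousLinearMap.continuous _).comp
        (MinTensor.continuous_star.mul continuous_id))
    | ih x => rw [MinTensor.star_coe, ← map_mul, MinTensor.extend_coe]; exact prodAlg_nonneg φ ψ x

lemma prod_coe (φ : State A) (ψ : State B) (x : A ⊗[ℂ] B) :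
    φ.prod ψ (MinTensor.coeAlgHom x) = prodAlg φ ψ x :=
  MinTensor.extend_coe _ (norm_prodAlg_le φ ψ) _

lemma prod_tmul (φ : State A) (ψ : State B) (a : A) (b : B) :
    φ.prod ψ (MinTensor.tmul a b) = φ a * ψ b :=
  prod_coe φ ψ _

section measure

variable {X : Type u} [MetricSpace X] [CompactSpace X]

/-- A real-valued continuous function, regarded as a complex-valued one. -/
def ofRealFun (f : C(X, ℝ)) : C(X, ℂ) := ⟨fun x => (f x : ℂ), by fun_prop⟩

lemma ofRealFun_nonneg (φ : State C(X, ℂ)) {f : C(X, ℝ)} (hf : ∀ x, 0 ≤ f x) :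
    0 ≤ φ (ofRealFun f) := by
  have h : ofRealFun f = star (ofRealFun ⟨fun x => Real.sqrt (f x), by fun_prop⟩) *
      ofRealFun ⟨fun x => Real.sqrt (f x), by fun_prop⟩ := by
    ext x
    simp only [ofRealFun, ContinuousMap.coe_mk, ContinuousMap.mul_apply, ContinuousMap.star_apply,
      Complex.star_def, Complex.conj_ofReal]
    rw [← Complex.ofReal_mul, Real.mul_self_sqrt (hf x)]
  rw [h]
  exact φ.nonneg' _

lemma im_ofRealFun (φ : State C(X, ℂ)) (f : C(X, ℝ)) : (φ (ofRealFun f)).im = 0 := by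
  have h : ofRealFun f = ofRealFun (f ⊔ 0) - ofRealFun (-f ⊔ 0) := by
    ext x
    simp only [ofRealFun, ContinuousMap.coe_mk, ContinuousMap.sub_apply, ContinuousMap.sup_apply,
      ContinuousMap.neg_apply, ContinuousMap.zero_apply]
    rw [← Complex.ofReal_sub]
    congr 1
    rcases le_total 0 (f x) with h | h
    · rw [sup_eq_left.mpr h, sup_eq_right.mpr (by linarith), sub_zero]
    · rw [sup_eq_right.mpr h, sup_eq_left.mpr (by linarith)]; ring
  rw [h, map_sub, Complex.sub_im,
    ← (Complex.nonneg_iff.mp (φ.ofRealFun_nonneg (f := f ⊔ 0) fun x => le_sup_right)).2,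
    ← (Complex.nonneg_iff.mp (φ.ofRealFun_nonneg (f := -f ⊔ 0) fun x => le_sup_right)).2, sub_zero]

variable [MeasurableSpace X] [BorelSpace X]

lemma integrable (μ : ProbabilityMeasure X) (f : C(X, ℂ)) : Integrable f (μ : Measure X) :=
  Integrable.of_bound f.continuous.aestronglyMeasurable ‖f‖
    (Filter.Eventually.of_forall fun x => f.norm_coe_le_norm x)

/-- The state `f ↦ ∫ f dμ` on `C(X)` given by a Borel probability measure `μ`. -/
def ofMeasure (μ : ProbabilityMeasure X) : State C(X, ℂ) where
  toCLM := LinearMap.mkContinuous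
    { toFun := fun f => ∫ x, f x ∂(μ : Measure X)
      map_add' := fun f g => integral_add (integrable μ f) (integrable μ g)
      map_smul' := fun c f => integral_smul c f } 1 fun f => by
        refine (norm_integral_le_of_norm_le_const
          (Filter.Eventually.of_forall fun x => f.norm_coe_le_norm x)).trans ?_
        simp
  map_one' := by simp
  nonneg' f := by
    have h : ∀ x, (star f * f) x = ((‖f x‖ ^ 2 : ℝ) : ℂ) := fun x => by
      simp [← Complex.conj_mul']
    simp only [LinearMap.mkContinuous_apply, LinearMap.coe_mk, AddHom.coe_mk, h]
    rw [integral_complex_ofReal]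
    exact_mod_cast integral_nonneg fun x => sq_nonneg _

lemma ofMeasure_apply (μ : ProbabilityMeasure X) (f : C(X, ℂ)) :
    ofMeasure μ f = ∫ x, f x ∂(μ : Measure X) := rfl

/-- The positive functional on real-valued continuous functions given by a state on `C(X)`. -/
def realFunctional (φ : State C(X, ℂ)) : CompactlySupportedContinuousMap X ℝ →ₚ[ℝ] ℝ :=
  PositiveLinearMap.mk₀
    { toFun := fun f => (φ (ofRealFun f.toContinuousMap)).re
      map_add' := fun f g => by
        rw [← Complex.add_re, ← map_add]
        congr 2
        ext x
        simp [ofRealFun]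
      map_smul' := fun c f => by
        have h : ofRealFun (c • f).toContinuousMap = (c : ℂ) • ofRealFun f.toContinuousMap := by
          ext x
          simp [ofRealFun]
        rw [h, map_smul]
        simp }
    fun f hf => (Complex.nonneg_iff.mp (φ.ofRealFun_nonneg (f := f.toContinuousMap) hf)).1

lemma exists_measure (φ : State C(X, ℂ)) :
    ∃ μ : ProbabilityMeasure X, ∀ f : C(X, ℂ), ∫ x, f x ∂(μ : Measure X) = φ f := by
  let m : Measure X := RealRMK.rieszMeasure φ.realFunctional
  have hreg : m.Regular := RealRMK.regular_rieszMeasure φ.realFunctional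
  have hfin : IsFiniteMeasure m := ⟨isCompact_univ.measure_lt_top⟩
  have hreal : ∀ f : C(X, ℝ), ((∫ x, f x ∂m : ℝ) : ℂ) = φ (ofRealFun f) := fun f => by
    have h : ∫ x, f x ∂m = (φ (ofRealFun f)).re :=
      RealRMK.integral_rieszMeasure φ.realFunctional ⟨f, HasCompactSupport.of_compactSpace f⟩
    rw [h]
    exact Complex.ext (Complex.ofReal_re _) (by rw [im_ofRealFun, Complex.ofReal_im])
  have hone : ((∫ x, (1 : C(X, ℝ)) x ∂m : ℝ) : ℂ) = 1 := by
    rw [hreal, ← φ.map_one']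
    congr 1
  have hprob : IsProbabilityMeasure m := by
    have h : m.real Set.univ = 1 := by simpa using hone
    exact ⟨by rw [← ENNReal.ofReal_one, ← h, ofReal_measureReal]⟩
  refine ⟨⟨m, hprob⟩, fun f => ?_⟩
  let fr : C(X, ℝ) := ⟨fun x => (f x).re, by fun_prop⟩
  let fi : C(X, ℝ) := ⟨fun x => (f x).im, by fun_prop⟩
  have hf : f = ofRealFun fr + Complex.I • ofRealFun fi := by
    ext x
    simp only [ofRealFun, fr, fi, ContinuousMap.coe_mk, ContinuousMap.add_apply,
      ContinuousMap.smul_apply, smul_eq_mul]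
    rw [mul_comm, Complex.re_add_im]
  have hint : Integrable f m := integrable ⟨m, hprob⟩ f
  calc ∫ x, f x ∂m = (∫ x, fr x ∂m : ℝ) + (∫ x, fi x ∂m : ℝ) * Complex.I :=
        (integral_re_add_im hint).symm
    _ = φ f := by
        conv_rhs => rw [hf]
        rw [hreal, hreal, map_add, map_smul, smul_eq_mul, mul_comm]

/-- The Borel probability measure corresponding to a state on `C(X)` (Riesz representation). -/
def toMeasure (φ : State C(X, ℂ)) : ProbabilityMeasure X := φ.exists_measure.choose

lemma integral_toMeasure (φ : State C(X, ℂ)) (f : C(X, ℂ)) :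
    ∫ x, f x ∂(φ.toMeasure : Measure X) = φ f :=
  φ.exists_measure.choose_spec f

end measure

end State

/-- A C*-algebraic compact quantum group structure `(A, Δ)` on the unital C*-algebra `A`. -/
structure CompactQuantumGroup (A : Type u) [CStarAlgebra A] where
  /-- the comultiplication, a unital `*`-homomorphism -/
  Δ : A →⋆ₐ[ℂ] MinTensor A A
  /-- coassociativity: `(Δ ⊗ id) Δ = (id ⊗ Δ) Δ` -/
  coassoc : ∀ a, MinTensor.IsAssoc (MinTensor.map Δ (StarAlgHom.id ℂ A) (Δ a))
    (MinTensor.map (StarAlgHom.id ℂ A) Δ (Δ a))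
  dense_left : Dense (Submodule.span ℂ {x | ∃ a b : A, x = MinTensor.tmul a 1 * Δ b} :
    Set (MinTensor A A))
  dense_right : Dense (Submodule.span ℂ {x | ∃ a b : A, x = MinTensor.tmul 1 a * Δ b} :
    Set (MinTensor A A))

/-- A right coaction of the compact quantum group `G = (A, Δ)` on the unital C*-algebra `B`. -/
structure Coaction {A : Type u} [CStarAlgebra A] (G : CompactQuantumGroup A)
    (B : Type u) [CStarAlgebra B] where
  /-- the coaction map, a unital `*`-homomorphism -/
  ρ : B →⋆ₐ[ℂ] MinTensor B A
  /-- `(ρ ⊗ id) ρ = (id ⊗ Δ) ρ` -/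
  coassoc : ∀ b, MinTensor.IsAssoc (MinTensor.map ρ (StarAlgHom.id ℂ A) (ρ b))
    (MinTensor.map (StarAlgHom.id ℂ B) G.Δ (ρ b))
  dense : Dense (Submodule.span ℂ {x | ∃ (a : A) (b : B), x = MinTensor.tmul 1 a * ρ b} :
    Set (MinTensor B A))

section metric

/-- An action of the compact quantum group `G` on the compact space `X`: a coaction on `C(X)`. -/
abbrev QuantumAction {A : Type u} [CStarAlgebra A] (G : CompactQuantumGroup A)
    (X : Type u) [TopologicalSpace X] [CompactSpace X] :=
  Coaction G C(X, ℂ)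

variable {X : Type u} [MetricSpace X] [CompactSpace X] [MeasurableSpace X] [BorelSpace X]

/-- The probability measure `μ ◁ ψ` on `X`, given by
`∫ f d(μ ◁ ψ) = (μ ⊗ ψ)(ρ(f))` for all `f ∈ C(X)`. -/
def QuantumAction.act {A : Type u} [CStarAlgebra A] {G : CompactQuantumGroup A}
    (α : QuantumAction G X) (μ : ProbabilityMeasure X) (ψ : State A) : ProbabilityMeasure X :=
  State.toMeasure (((State.ofMeasure μ).prod ψ).comp α.ρ)

lemma QuantumAction.integral_act {A : Type u} [CStarAlgebra A] {G : CompactQuantumGroup A}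
    (α : QuantumAction G X) (μ : ProbabilityMeasure X) (ψ : State A) (f : C(X, ℂ)) :
    ∫ x, f x ∂(α.act μ ψ : Measure X) = (State.ofMeasure μ).prod ψ (α.ρ f) :=
  State.integral_toMeasure _ f

/-- The set `Π(μ, ν)` of couplings: probability measures on `X × X` with marginals `μ` and `ν`. -/
def couplings (μ ν : ProbabilityMeasure X) : Set (ProbabilityMeasure (X × X)) :=
  {π | (π : Measure (X × X)).map Prod.fst = μ ∧ (π : Measure (X × X)).map Prod.snd = ν}

/-- The Wasserstein `p`-distance
`W_p(μ, ν) = inf_{π ∈ Π(μ, ν)} (∫ d(x, y)^p dπ(x, y))^{1/p}`. -/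
def wasserstein (p : ℝ) (μ ν : ProbabilityMeasure X) : ℝ :=
  ⨅ π : couplings μ ν, (∫ z, dist z.1 z.2 ^ p ∂(π.1 : Measure (X × X))) ^ (1 / p)

/-- The action is (Lip_p)-isometric: `W_p(μ ◁ ψ, ν ◁ ψ) ≤ W_p(μ, ν)` for all probability
measures `μ, ν` on `X` and all states `ψ` on `A`. -/
def LipIsometric {A : Type u} [CStarAlgebra A] {G : CompactQuantumGroup A}
    (α : QuantumAction G X) (p : ℝ) : Prop :=
  ∀ (μ ν : ProbabilityMeasure X) (ψ : State A),
    wasserstein p (α.act μ ψ) (α.act ν ψ) ≤ wasserstein p μ ν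

end metric

end

end QuantumIsometry

/-! Fix a state `ψ` and let `K` be the map sending `μ` to `μ ◁ ψ`. Slicing the coaction by `ψ` shows
that `K` is dual to an operator on `C(X)`, so `K μ` is the average of the measures `K δ_x` over `μ`,
and these averages depend continuously on `x` (`isFeller_act`). The rest is classical transport
theory for such a `K`.

On Dirac masses every `W_p` is bounded by the distance, so the `p`-condition gives `W_p(K δ_x, K
δ_y) ≤ d(x, y)`. By Jensen, the `q`-cost of a coupling is at most its `p`-cost, so `K δ_x` and `K
δ_y` have couplings of `q`-cost at most `d(x, y) + ε` (`exists_coupling_diracProba`).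

Given a coupling `π` of `μ` and `ν`, averaging these couplings over `π` should give a coupling of `K
μ` and `K ν` of no larger `q`-cost. To avoid a measurable choice of couplings, `(x, y)` is first
rounded to finitely many values by a simple function; the resulting mixtures have approximately
correct marginals, and a weak limit point has exactly correct ones by the Feller property
(`map_eq_of_tendsto`, `exists_coupling_integral_le`). The infimum over `π` concludes. -/

open Filter Topology ProbabilityTheory

namespace QuantumIsometry

noncomputable section

variable {X : Type u} [MetricSpace X] [CompactSpace X] [MeasurableSpace X] [BorelSpace X]

/-! ### Slice maps and the Feller property of the action -/

section slice

variable {A : Type u} [CStarAlgebra A]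

lemma State.ofMeasure_diracProba (x : X) (f : C(X, ℂ)) :
    State.ofMeasure (diracProba x) f = f x := by
  rw [State.ofMeasure_apply]
  exact integral_dirac f x

/-- The slice map `f ⊗ a ↦ ψ(a) f` on the algebraic tensor product. -/
def sliceAlg (ψ : State A) : C(X, ℂ) ⊗[ℂ] A →ₗ[ℂ] C(X, ℂ) :=
  TensorProduct.lift (LinearMap.mk₂ ℂ (fun f a => ψ a • f)
    (fun f g a => smul_add _ _ _) (fun c f a => smul_comm _ _ _)
    (fun f a b => by rw [map_add, add_smul]) (fun c f a => by rw [map_smul, smul_assoc]))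

lemma sliceAlg_tmul {X : Type u} [MetricSpace X] [CompactSpace X] (ψ : State A)
    (f : C(X, ℂ)) (a : A) : sliceAlg ψ (f ⊗ₜ a) = ψ a • f := rfl

lemma ofMeasure_sliceAlg (ψ : State A) (μ : ProbabilityMeasure X) (z : C(X, ℂ) ⊗[ℂ] A) :
    State.ofMeasure μ (sliceAlg ψ z) = State.prodAlg (State.ofMeasure μ) ψ z := by
  induction z using TensorProduct.induction_on with
  | zero => simp
  | add z w hz hw => rw [map_add, map_add, map_add, hz, hw]
  | tmul f a => rw [sliceAlg_tmul, State.prodAlg_tmul, map_smul, smul_eq_mul, mul_comm]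

/-- Evaluation at `x` turns the slice map into the product state `δ_x ⊗ ψ`, which is contractive for
the minimal norm; the sup norm then takes the supremum over `x`. -/
lemma norm_sliceAlg_le (ψ : State A) (z : C(X, ℂ) ⊗[ℂ] A) : ‖sliceAlg ψ z‖ ≤ minNorm z := by
  refine (ContinuousMap.norm_le _ (minNorm_nonneg z)).2 fun x => ?_
  rw [← State.ofMeasure_diracProba x, ofMeasure_sliceAlg]
  exact State.norm_prodAlg_le _ _ _

/-- The slice map `id ⊗ ψ` from `C(X) ⊗ A` to `C(X)`. -/
def slice (ψ : State A) : MinTensor C(X, ℂ) A →L[ℂ] C(X, ℂ) :=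
  MinTensor.extend (sliceAlg ψ) (norm_sliceAlg_le ψ)

lemma ofMeasure_slice (ψ : State A) (μ : ProbabilityMeasure X) (T : MinTensor C(X, ℂ) A) :
    State.ofMeasure μ (slice ψ T) = (State.ofMeasure μ).prod ψ T := by
  induction T using MinTensor.denseRange_coe.induction_on with
  | hp =>
    exact isClosed_eq ((ContinuousLinearMap.continuous _).comp (ContinuousLinearMap.continuous _))
      (ContinuousLinearMap.continuous _)
  | ih z => rw [slice, MinTensor.extend_coe, State.prod_coe, ofMeasure_sliceAlg]

end slice

/-- A map between spaces of probability measures is Feller if it is dual to an operator on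
continuous functions. -/
def IsFeller (K : ProbabilityMeasure X → ProbabilityMeasure X) : Prop :=
  ∀ f : C(X, ℝ), ∃ h : C(X, ℝ), ∀ μ : ProbabilityMeasure X,
    ∫ x, f x ∂(K μ : Measure X) = ∫ x, h x ∂(μ : Measure X)

lemma isFeller_act {A : Type u} [CStarAlgebra A] {G : CompactQuantumGroup A}
    (α : QuantumAction G X) (ψ : State A) : IsFeller fun μ => α.act μ ψ := by
  intro f
  let g : C(X, ℂ) := slice ψ (α.ρ (State.ofRealFun f))
  -- Taking real parts suffices: the integral of the real function `f` equals that of `g`, so `g`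
  -- need not be shown to be real-valued.
  refine ⟨⟨fun x => (g x).re, by fun_prop⟩, fun μ => ?_⟩
  have h := α.integral_act μ ψ (State.ofRealFun f)
  rw [← ofMeasure_slice, State.ofMeasure_apply] at h
  have h1 : ∫ x, State.ofRealFun f x ∂(α.act μ ψ : Measure X) =
      ((∫ x, f x ∂(α.act μ ψ : Measure X) : ℝ) : ℂ) := integral_complex_ofReal
  rw [h1] at h
  have h2 : ∫ x, (g x).re ∂(μ : Measure X) = (∫ x, g x ∂(μ : Measure X)).re :=
    integral_re (State.integrable μ g)
  exact (h2.trans (by rw [← h, Complex.ofReal_re])).symm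

/-! ### Couplings, transport costs and Dirac masses -/

lemma integrable_of_continuous {Y : Type*} [TopologicalSpace Y] [CompactSpace Y]
    [MeasurableSpace Y] [BorelSpace Y] [SecondCountableTopology Y]
    (μ : Measure Y) [IsFiniteMeasure μ] {f : Y → ℝ} (hf : Continuous f) : Integrable f μ :=
  hf.integrable_of_hasCompactSupport (HasCompactSupport.of_compactSpace f)

lemma continuous_dist_rpow {X : Type*} [MetricSpace X] {q : ℝ} (hq : 0 ≤ q) :
    Continuous fun z : X × X => dist z.1 z.2 ^ q :=
  continuous_dist.rpow_const fun _ => Or.inr hq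

lemma integral_dist_rpow_nonneg {X : Type*} [MetricSpace X] [MeasurableSpace X] (q : ℝ)
    (m : Measure (X × X)) :
    0 ≤ ∫ z, dist z.1 z.2 ^ q ∂m :=
  integral_nonneg fun _ => Real.rpow_nonneg dist_nonneg _

lemma wasserstein_le {X : Type u} [MetricSpace X] [MeasurableSpace X] {p : ℝ}
    {μ ν : ProbabilityMeasure X} {π : ProbabilityMeasure (X × X)}
    (hπ : π ∈ couplings μ ν) :
    wasserstein p μ ν ≤ (∫ z, dist z.1 z.2 ^ p ∂(π : Measure (X × X))) ^ (1 / p) :=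
  ciInf_le (f := fun π : couplings μ ν =>
      (∫ z, dist z.1 z.2 ^ p ∂(π.1 : Measure (X × X))) ^ (1 / p))
    ⟨0, by
      rintro _ ⟨π, rfl⟩
      exact Real.rpow_nonneg (integral_dist_rpow_nonneg _ _) _⟩ ⟨π, hπ⟩

/-- The product measure is a coupling. This matters because a real infimum over an empty family
would be the default value `0`. -/
lemma nonempty_couplings (μ ν : ProbabilityMeasure X) : Nonempty (couplings μ ν) :=
  ⟨μ.prod ν, by
    constructor
    · rw [ProbabilityMeasure.toMeasure_prod, Measure.map_fst_prod]; simp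
    · rw [ProbabilityMeasure.toMeasure_prod, Measure.map_snd_prod]; simp⟩

lemma diracProba_mem_couplings {X : Type u} [MeasurableSpace X] (x y : X) :
    diracProba (x, y) ∈ couplings (diracProba x) (diracProba y) := by
  constructor
  · exact Measure.map_dirac' measurable_fst (x, y)
  · exact Measure.map_dirac' measurable_snd (x, y)

lemma wasserstein_diracProba_le {p : ℝ} (hp : 1 ≤ p) (x y : X) :
    wasserstein p (diracProba x) (diracProba y) ≤ dist x y := by
  refine (wasserstein_le (diracProba_mem_couplings x y)).trans_eq ?_
  have h : ∫ z, dist z.1 z.2 ^ p ∂(diracProba (x, y) : Measure (X × X)) = dist x y ^ p :=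
    integral_dirac (fun z : X × X => dist z.1 z.2 ^ p) (x, y)
  rw [h, one_div, Real.rpow_rpow_inv dist_nonneg (by linarith)]

lemma rpow_integral_dist_mono {p q : ℝ} (hq : 1 ≤ q) (hqp : q ≤ p)
    (π : ProbabilityMeasure (X × X)) :
    (∫ z, dist z.1 z.2 ^ q ∂(π : Measure (X × X))) ^ (1 / q) ≤
      (∫ z, dist z.1 z.2 ^ p ∂(π : Measure (X × X))) ^ (1 / p) := by
  have hq0 : 0 < q := by linarith
  have hp0 : 0 < p := by linarith
  have hc := continuous_dist_rpow (X := X) hq0.le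
  -- Jensen's inequality for `t ↦ t ^ (p / q)`, convex on `[0, ∞)` because `p / q ≥ 1`.
  have key : (∫ z, dist z.1 z.2 ^ q ∂(π : Measure (X × X))) ^ (p / q) ≤
      ∫ z, (dist z.1 z.2 ^ q) ^ (p / q) ∂(π : Measure (X × X)) :=
    (convexOn_rpow ((one_le_div hq0).2 hqp)).map_integral_le
      (Real.continuous_rpow_const (by positivity)).continuousOn isClosed_Ici
      (Eventually.of_forall fun z => Real.rpow_nonneg dist_nonneg _)
      (integrable_of_continuous _ hc)
      (integrable_of_continuous _ (hc.rpow_const fun _ => Or.inr (by positivity)))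
  have h1 : ∀ z : X × X, (dist z.1 z.2 ^ q) ^ (p / q) = dist z.1 z.2 ^ p := fun z => by
    rw [← Real.rpow_mul dist_nonneg, mul_div_cancel₀ _ hq0.ne']
  simp only [h1] at key
  have h2 := Real.rpow_le_rpow (Real.rpow_nonneg (integral_dist_rpow_nonneg q _) _) key
    (one_div_nonneg.2 hp0.le)
  rwa [← Real.rpow_mul (integral_dist_rpow_nonneg q _),
    show p / q * (1 / p) = 1 / q by field_simp] at h2

/-- The slack `ε` makes the bound on the infimum strict, so a near-optimal coupling for the `p`-cost
exists without any attainment argument; Jensen then converts its cost to exponent `q`. -/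
lemma exists_coupling_diracProba {p q : ℝ} (hq : 1 ≤ q) (hqp : q ≤ p)
    {K : ProbabilityMeasure X → ProbabilityMeasure X}
    (hK : ∀ μ ν, wasserstein p (K μ) (K ν) ≤ wasserstein p μ ν) {ε : ℝ} (hε : 0 < ε)
    (z : X × X) :
    ∃ γ ∈ couplings (K (diracProba z.1)) (K (diracProba z.2)),
      ∫ w, dist w.1 w.2 ^ q ∂(γ : Measure (X × X)) ≤ (dist z.1 z.2 + ε) ^ q := by
  have hq0 : 0 < q := by linarith
  have h : wasserstein p (K (diracProba z.1)) (K (diracProba z.2)) < dist z.1 z.2 + ε :=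
    ((hK _ _).trans (wasserstein_diracProba_le (hq.trans hqp) _ _)).trans_lt
      (lt_add_of_pos_right _ hε)
  have := nonempty_couplings (K (diracProba z.1)) (K (diracProba z.2))
  obtain ⟨γ, hγ⟩ := exists_lt_of_ciInf_lt h
  refine ⟨γ.1, γ.2, ?_⟩
  have h1 := Real.rpow_le_rpow (Real.rpow_nonneg (integral_dist_rpow_nonneg q _) _)
    ((rpow_integral_dist_mono hq hqp γ.1).trans hγ.le) hq0.le
  rwa [one_div, Real.rpow_inv_rpow (integral_dist_rpow_nonneg q _) hq0.ne'] at h1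

/-! ### Mixtures of couplings along simple functions -/

/-- The mixture `∫ γ(s(z)) dπ(z)` of probability measures, for a simple function `s`. -/
def mixture {Y : Type*} [MeasurableSpace Y] (π : ProbabilityMeasure Y) (s : SimpleFunc Y Y)
    (γ : Y → ProbabilityMeasure Y) : ProbabilityMeasure Y :=
  ⟨(π : Measure Y).bind (s.map fun y => (γ y : Measure Y)),
    isProbabilityMeasure_bind (SimpleFunc.measurable _).aemeasurable
      (Eventually.of_forall fun y => by
        rw [SimpleFunc.map_apply]; infer_instance)⟩

lemma integral_mixture {Y : Type*} [TopologicalSpace Y] [CompactSpace Y]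
    [MeasurableSpace Y] [BorelSpace Y] [SecondCountableTopology Y] (π : ProbabilityMeasure Y)
    (s : SimpleFunc Y Y) (γ : Y → ProbabilityMeasure Y) {f : Y → ℝ} (hf : Continuous f) :
    ∫ y, f y ∂(mixture π s γ : Measure Y) =
      ∫ y, ∫ w, f w ∂(γ (s y) : Measure Y) ∂(π : Measure Y) := by
  -- `γ` is an arbitrary choice, but composed with a simple function it is measurable, hence a
  -- kernel; the mixture is its composition with the constant kernel `π`.
  let κ : Kernel Y Y :=
    ⟨s.map fun y => (γ y : Measure Y), SimpleFunc.measurable _⟩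
  have h : (κ ∘ₖ Kernel.const Unit (π : Measure Y)) () = mixture π s γ := by
    rw [Kernel.comp_apply, Kernel.const_apply]
    rfl
  rw [← h, Kernel.integral_comp (h ▸ integrable_of_continuous _ hf),
    Kernel.const_apply]
  rfl

lemma tendsto_integral_comp_simpleFunc {Y : Type*} [TopologicalSpace Y] [CompactSpace Y]
    [MeasurableSpace Y] [BorelSpace Y] [SecondCountableTopology Y] (π : ProbabilityMeasure Y)
    {s : ℕ → SimpleFunc Y Y} (hs : ∀ y, Tendsto (fun n => s n y) atTop (𝓝 y)) {f : Y → ℝ}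
    (hf : Continuous f) :
    Tendsto (fun n => ∫ y, f (s n y) ∂(π : Measure Y)) atTop (𝓝 (∫ y, f y ∂(π : Measure Y))) := by
  let F : C(Y, ℝ) := ⟨f, hf⟩
  refine tendsto_integral_of_dominated_convergence (fun _ => ‖F‖)
    (fun n => (hf.measurable.comp (s n).measurable).aestronglyMeasurable)
    (integrable_const _) (fun n => Eventually.of_forall fun y => F.norm_coe_le_norm (s n y))
    (Eventually.of_forall fun y => (hf.tendsto y).comp (hs y))

lemma exists_simpleFunc_tendsto_id (Y : Type*) [MetricSpace Y] [CompactSpace Y]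
    [MeasurableSpace Y] [BorelSpace Y] [Nonempty Y] :
    ∃ s : ℕ → SimpleFunc Y Y, ∀ y, Tendsto (fun n => s n y) atTop (𝓝 y) :=
  ⟨fun n => SimpleFunc.approxOn id measurable_id Set.univ (Classical.arbitrary Y)
      (Set.mem_univ _) n,
    fun y => SimpleFunc.tendsto_approxOn measurable_id (Set.mem_univ _) (by simp)⟩

/-! ### Passage to the limit and gluing of couplings -/

/-- A limit of approximate couplings is a coupling. -/
lemma map_eq_of_tendsto {K : ProbabilityMeasure X → ProbabilityMeasure X} (hK : IsFeller K)
    {π Γ : ProbabilityMeasure (X × X)} {s : ℕ → SimpleFunc (X × X) (X × X)}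
    (hs : ∀ y, Tendsto (fun n => s n y) atTop (𝓝 y))
    {γ : ℕ → X × X → ProbabilityMeasure (X × X)} {l : Filter ℕ} [l.NeBot] (hl : l ≤ atTop)
    (hΓ : Tendsto (fun n => mixture π (s n) (γ n)) l (𝓝 Γ)) {pr : X × X → X}
    (hpr : Continuous pr)
    (hγ : ∀ n z, (γ n z : Measure (X × X)).map pr = K (diracProba (pr z)))
    {μ : ProbabilityMeasure X} (hμ : (π : Measure (X × X)).map pr = μ) :
    (Γ : Measure (X × X)).map pr = K μ := by
  have : IsProbabilityMeasure ((Γ : Measure (X × X)).map pr) :=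
    Measure.isProbabilityMeasure_map hpr.measurable.aemeasurable
  refine ext_of_forall_integral_eq_of_IsFiniteMeasure fun f => ?_
  obtain ⟨h, hh⟩ := hK f.toContinuousMap
  rw [integral_map hpr.measurable.aemeasurable f.continuous.aestronglyMeasurable]
  have h1 := (ProbabilityMeasure.tendsto_iff_forall_integral_tendsto.1 hΓ)
    (BoundedContinuousFunction.mkOfCompact ⟨fun z => f (pr z), f.continuous.comp hpr⟩)
  -- With `h` the function dual to `f`, the integral of `f` against `K δ_x` is `h x`. So the
  -- marginal of the mixture is the image under `K` of the projected law of the rounded point.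
  have h2 : ∀ n, ∫ z, f (pr z) ∂(mixture π (s n) (γ n) : Measure (X × X)) =
      ∫ z, h (pr (s n z)) ∂(π : Measure (X × X)) := fun n => by
    refine (integral_mixture π (s n) (γ n) (f.continuous.comp hpr)).trans ?_
    congr 1 with z
    refine (integral_map (f := f) hpr.measurable.aemeasurable f.continuous.aestronglyMeasurable).symm.trans ?_
    rw [hγ]
    exact (hh _).trans (integral_dirac h _)
  have h3 := (tendsto_integral_comp_simpleFunc π hs (h.continuous.comp hpr)).mono_left hl
  have h4 : ∫ z, f (pr z) ∂(Γ : Measure (X × X)) = ∫ z, h (pr z) ∂(π : Measure (X × X)) :=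
    tendsto_nhds_unique (h1.congr h2) h3
  rw [h4, ← integral_map (f := h) hpr.measurable.aemeasurable h.continuous.aestronglyMeasurable,
    hμ]
  exact (hh μ).symm

/-- Pointwise transport bounds between Dirac images integrate to a bound along any coupling; the
tolerance and the rounding error vanish together in the limit. -/
lemma exists_coupling_integral_le {q : ℝ} (hq : 1 ≤ q)
    {K : ProbabilityMeasure X → ProbabilityMeasure X} (hK : IsFeller K)
    (hd : ∀ ε : ℝ, 0 < ε → ∀ z : X × X,
      ∃ γ ∈ couplings (K (diracProba z.1)) (K (diracProba z.2)),
        ∫ w, dist w.1 w.2 ^ q ∂(γ : Measure (X × X)) ≤ (dist z.1 z.2 + ε) ^ q)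
    {μ ν : ProbabilityMeasure X} {π : ProbabilityMeasure (X × X)} (hπ : π ∈ couplings μ ν) :
    ∃ Γ ∈ couplings (K μ) (K ν), ∫ w, dist w.1 w.2 ^ q ∂(Γ : Measure (X × X)) ≤
      ∫ w, dist w.1 w.2 ^ q ∂(π : Measure (X × X)) := by
  have hq0 : 0 ≤ q := by linarith
  have hne : Nonempty (X × X) := π.nonempty
  obtain ⟨s, hs⟩ := exists_simpleFunc_tendsto_id (X × X)
  choose γ hγ hcost using fun n : ℕ => hd (1 / ((n : ℝ) + 1)) (by positivity)
  -- Probability measures on the compact space `X × X` form a weakly compact space, so the mixtures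
  -- converge along a free ultrafilter, with no subsequence to extract.
  obtain ⟨Γ, -, hΓ⟩ := isCompact_univ.ultrafilter_le_nhds
    ((hyperfilter ℕ).map fun n => mixture π (s n) (γ n)) (by simp)
  have hΓ' : Tendsto (fun n => mixture π (s n) (γ n)) (hyperfilter ℕ : Filter ℕ) (𝓝 Γ) := hΓ
  refine ⟨Γ, ⟨?_, ?_⟩, ?_⟩
  · exact map_eq_of_tendsto hK hs Nat.hyperfilter_le_atTop hΓ' continuous_fst
      (fun n z => (hγ n z).1) hπ.1
  · exact map_eq_of_tendsto hK hs Nat.hyperfilter_le_atTop hΓ' continuous_snd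
      (fun n z => (hγ n z).2) hπ.2
  have hc := continuous_dist_rpow (X := X) hq0
  have h1 := (ProbabilityMeasure.tendsto_iff_forall_integral_tendsto.1 hΓ')
    (BoundedContinuousFunction.mkOfCompact ⟨_, hc⟩)
  have h2 : Tendsto (fun n => ∫ z, (dist (s n z).1 (s n z).2 + 1 / ((n : ℝ) + 1)) ^ q
      ∂(π : Measure (X × X))) atTop (𝓝 (∫ z, dist z.1 z.2 ^ q ∂(π : Measure (X × X)))) := by
    -- The dominating constant uses that distances are at most the diameter and `1 / (n + 1) ≤ 1`.
    refine tendsto_integral_of_dominated_convergence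
      (fun _ => (Metric.diam (Set.univ : Set X) + 1) ^ q) (fun n => ?_) (integrable_const _)
      (fun n => Eventually.of_forall fun z => ?_) (Eventually.of_forall fun z => ?_)
    · exact Measurable.aestronglyMeasurable
        (((continuous_dist.measurable.comp (s n).measurable).add_const _).pow_const q)
    · rw [Real.norm_of_nonneg (by positivity)]
      gcongr
      · exact Metric.dist_le_diam_of_mem isCompact_univ.isBounded (Set.mem_univ _) (Set.mem_univ _)
      · rw [div_le_one (by positivity)]
        linarith [(n.cast_nonneg : (0 : ℝ) ≤ n)]
    · have h := ((continuous_dist.tendsto z).comp (hs z)).add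
        tendsto_one_div_add_atTop_nhds_zero_nat
      rw [add_zero] at h
      exact ((Real.continuous_rpow_const hq0).tendsto _).comp h
  refine le_of_tendsto_of_tendsto' h1 (h2.mono_left Nat.hyperfilter_le_atTop) fun n => ?_
  refine (integral_mixture π (s n) (γ n) hc).trans_le ?_
  -- The cost of `γ n y` need not be measurable in `y`; after composition with `s n` both sides are
  -- simple functions, hence integrable.
  let t : SimpleFunc (X × X) ℝ := (s n).map fun y =>
    ∫ w : X × X, dist w.1 w.2 ^ q ∂(γ n y : Measure (X × X))
  let t' : SimpleFunc (X × X) ℝ := (s n).map fun y => (dist y.1 y.2 + 1 / ((n : ℝ) + 1)) ^ q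
  exact integral_mono (f := t) (g := t') (SimpleFunc.integrable_of_isFiniteMeasure _)
    (SimpleFunc.integrable_of_isFiniteMeasure _) fun z => hcost n (s n z)

theorem wasserstein_le_of_isFeller {p q : ℝ} (hq : 1 ≤ q) (hqp : q ≤ p)
    {K : ProbabilityMeasure X → ProbabilityMeasure X} (hK : IsFeller K)
    (hp : ∀ μ ν, wasserstein p (K μ) (K ν) ≤ wasserstein p μ ν) (μ ν : ProbabilityMeasure X) :
    wasserstein q (K μ) (K ν) ≤ wasserstein q μ ν := by
  have := nonempty_couplings μ ν
  refine le_ciInf fun π => ?_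
  obtain ⟨Γ, hΓ, hle⟩ := exists_coupling_integral_le hq hK
    (fun ε hε => exists_coupling_diracProba hq hqp hp hε) π.2
  exact (wasserstein_le hΓ).trans (Real.rpow_le_rpow (integral_dist_rpow_nonneg q _) hle
    (one_div_nonneg.2 (by linarith)))

end

end QuantumIsometry

theorem mainTheorem9 {X A : Type u} [MetricSpace X] [CompactSpace X] [MeasurableSpace X]
    [BorelSpace X] [CStarAlgebra A] (G : QuantumIsometry.CompactQuantumGroup A)
    (α : QuantumIsometry.QuantumAction G X) (p q : ℝ) (hq : 1 ≤ q) (hqp : q ≤ p)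
    (hLip : QuantumIsometry.LipIsometric α p) : QuantumIsometry.LipIsometric α q :=
  fun μ ν ψ => QuantumIsometry.wasserstein_le_of_isFeller hq hqp
    (QuantumIsometry.isFeller_act α ψ) (fun μ ν => hLip μ ν ψ) μ ν
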